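/- Let $I=\{0,1\}$, let $\mathbb S$ be the left shift on $I^{\mathbb Z}$, $(\mathbb S w)(n)=w(n+1)$, and let $\mathbb O$ be the odometer on $I^{\mathbb N}$ (if $\alpha_1=\dots=\alpha_{n-1}=1$ and $\alpha_n=0$, then $\mathbb O[\alpha]_i=0$ for $i<n$, $\mathbb O[\alpha]_n=1$, and $\mathbb O[\alpha]_i=\alpha_i$ for $i>n$; i.e. addition of $1$ in the group of $2$-adic integers). Let $m$ be the Lebesgue (uniform product) measure on $I^{\mathbb N}$, let $\mathbb M$ be the set of Borel probability measures on $I^{\mathbb Z}\times I^{\mathbb N}$ invariant under $\mathbb S\times\mathbb O$, and let $\operatorname{Ex}(\mathbb M)$ be the set of ergodic measures in $\mathbb M$. For a transformation $T$ and a measure $\mu$, $T\mu$ denotes the pushforward. For $k\ge 0$ and $0\le r\le 2^k-1$ put $A_{r,k}=\{\alpha\in I^{\mathbb N}:\sum_{i=1}^k\alpha_i2^{i-1}=r\}$, and for $\nu\in\mathbb M$ let $\theta_k[\nu]$ be the projection to $I^{\mathbb Z}$ of the normalized restriction of $\nu$ to $I^{\mathbb Z}\times A_{0,k}$; thus $\theta_0[\nu]$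 is the projection of $\nu$ to $I^{\mathbb Z}$. A measure $\nu\in\mathbb M$ is called aperiodic if it is not of the form $\sum_{i=0}^{2^k-1}\mathbb S^i\eta\times(\chi_{A_{i,k}}m)$ for any $k\ge0$ and any Borel probability measure $\eta$ on $I^{\mathbb Z}$ invariant under $\mathbb S^{2^k}$. Let $\nu$ be an aperiodic measure in $\operatorname{Ex}(\mathbb M)$. Then 1) the measures $\theta_k[\nu]$ and $\mathbb S^r\theta_k[\nu]$ are mutually singular for $k\ge1$ and $1\le r\le 2^k-1$; 2) for $\theta_0[\nu]$-almost all $w\in I^{\mathbb Z}$ the conditional measure of $\nu$ on the section $\{w\}\times I^{\mathbb N}$ is a delta measure; 3) the projection of $I^{\mathbb Z}\times I^{\mathbb N}$ to $I^{\mathbb Z}$ is an isomorphism (mod $0$) of the dynamical systems $(I^{\mathbb Z}\times I^{\mathbb N},\nu,\mathbb S\times\mathbb O)$ and $(I^{\mathbb Z},\theta_0[\nu],\mathbb S)$; 4) the numbers $\varrho_n=e^{2^{1-n}\pi i}$, $n\ge0$, are eigenvalues of the unitary operator $f\mapsto f\circ\mathbb S$ on the complex space $L^2(I^{\mathbb Z},\theta_0[\nu])$;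 5) the dynamical system $(I^{\mathbb Z},\theta_0[\nu],\mathbb S)$ has a quotient isomorphic to the odometer $(I^{\mathbb N},m,\mathbb O)$. -/

import Mathlib

open MeasureTheory ProbabilityTheory

namespace OrderedPairs

/-- The space `I^ℤ`, `I = {0, 1}`, with its product (Borel) σ-algebra. -/
abbrev SeqZ : Type := ℤ → Fin 2

/-- The space `I^ℕ`, `I = {0, 1}`. The digits, numbered `1, 2, 3, …` in the usual notation
`α = (α₁, α₂, …)`, are numbered here from `0`: `α i` stands for `α_{i+1}`. -/
abbrev SeqN : Type := ℕ → Fin 2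

/-- The left shift `𝕊` on `I^ℤ`. -/
def shift (w : SeqZ) : SeqZ := fun n => w (n + 1)

/-- The odometer `𝕆` on `I^ℕ`: the digits before the first `0` (all equal to `1`) become `0`, this
first `0` becomes `1`, and the later digits are unchanged. In other words a digit is flipped iff all
the earlier digits are `1`. This is addition of one in the group of 2-adic integers; at the single
point `(1, 1, 1, …)`, which has no digit `0` and is a null set for every invariant probability
measure, the value is `(0, 0, 0, …)`. -/
def odometer (α : SeqN) : SeqN :=
  fun i => if ∀ j < i, α j = 1 then 1 - α i else α i

/-- The transformation `𝕊 × 𝕆` of `I^ℤ × I^ℕ`. -/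
def shiftOdometer : SeqZ × SeqN → SeqZ × SeqN := Prod.map shift odometer

/-- The Lebesgue (Haar, fair coin tossing) measure `m` on `I^ℕ`. -/
noncomputable def lebesgue : Measure SeqN :=
  Measure.infinitePi fun _ : ℕ => (PMF.uniformOfFintype (Fin 2)).toMeasure

/-- The set `𝕄` of Borel probability measures on `I^ℤ × I^ℕ` invariant under `𝕊 × 𝕆`. -/
def invMeasures : Set (Measure (SeqZ × SeqN)) :=
  {ν | IsProbabilityMeasure ν ∧ MeasurePreserving shiftOdometer ν ν}

/-- The set `Ex(𝕄)` of ergodic measures in `𝕄`. -/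
def ergodicInvMeasures : Set (Measure (SeqZ × SeqN)) :=
  {ν | ν ∈ invMeasures ∧ Ergodic shiftOdometer ν}

/-- The cylinder `A_{r,k} = {α ∈ I^ℕ : ∑_{i=1}^k α_i 2^{i-1} = r}`. -/
def cyl (r k : ℕ) : Set SeqN :=
  {α | ∑ i ∈ Finset.range k, (α i : ℕ) * 2 ^ i = r}

/-- `𝒫_{r,k}[ν]`: the projection to `I^ℤ` of the normalized restriction of `ν` to
`I^ℤ × A_{r,k}`. -/
noncomputable def partialProj (r k : ℕ) (ν : Measure (SeqZ × SeqN)) : Measure SeqZ :=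
  (ProbabilityTheory.cond ν (Prod.snd ⁻¹' cyl r k)).map Prod.fst

/-- `θ_k[ν] = 𝒫_{0,k}[ν]`. -/
noncomputable def theta (k : ℕ) (ν : Measure (SeqZ × SeqN)) : Measure SeqZ :=
  partialProj 0 k ν

/-- The set `ℳ_k` of Borel probability measures on `I^ℤ` invariant under `𝕊^{2^k}`. -/
def powInvMeasures (k : ℕ) : Set (Measure SeqZ) :=
  {η | IsProbabilityMeasure η ∧ MeasurePreserving (shift^[2 ^ k]) η η}

/-- `D_k[η] = ∑_{i=0}^{2^k-1} 𝕊^i η × (χ_{A_{i,k}} m)`. -/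
noncomputable def periodicMeasure (k : ℕ) (η : Measure SeqZ) : Measure (SeqZ × SeqN) :=
  ∑ i ∈ Finset.range (2 ^ k), (η.map (shift^[i])).prod (lebesgue.restrict (cyl i k))

/-- `ν` is a measure of periodic type: `ν = D_k[η]` for some `k ≥ 0` and `η ∈ ℳ_k`. -/
def IsOfPeriodicType (ν : Measure (SeqZ × SeqN)) : Prop :=
  ∃ k : ℕ, ∃ η ∈ powInvMeasures k, ν = periodicMeasure k η

/-- `ν ∈ 𝕄` is aperiodic if it is not a measure of periodic type. -/
def IsAperiodic (ν : Measure (SeqZ × SeqN)) : Prop :=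
  ν ∈ invMeasures ∧ ¬ IsOfPeriodicType ν

/-- `φ` is a factor (quotient) map from the measure preserving system `(X, μ, T)` onto the measure
preserving system `(Y, μ', U)`. -/
structure IsFactorMap {X Y : Type*} [MeasurableSpace X] [MeasurableSpace Y]
    (φ : X → Y) (T : X → X) (μ : Measure X) (U : Y → Y) (μ' : Measure Y) : Prop where
  source_preserving : MeasurePreserving T μ μ
  target_preserving : MeasurePreserving U μ' μ'
  map_preserving : MeasurePreserving φ μ μ'
  semiconj : φ ∘ T =ᵐ[μ] U ∘ φ

/-- `φ` is an isomorphism (mod 0) of the measure preserving systems `(X, μ, T)` and `(Y, μ', U)`: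
a factor map which has a measure preserving inverse mod 0. -/
structure IsSystemIso {X Y : Type*} [MeasurableSpace X] [MeasurableSpace Y]
    (φ : X → Y) (T : X → X) (μ : Measure X) (U : Y → Y) (μ' : Measure Y) : Prop
    extends IsFactorMap φ T μ U μ' where
  exists_inverse : ∃ ψ : Y → X, MeasurePreserving ψ μ' μ ∧
    ψ ∘ φ =ᵐ[μ] id ∧ φ ∘ ψ =ᵐ[μ'] id

/-- The Koopman operator `f ↦ f ∘ T` on the complex space `L²(X, μ)`. -/
noncomputable def koopman {X : Type*} [MeasurableSpace X] {μ : Measure X} (T : X → X)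
    (hT : MeasurePreserving T μ μ) : Module.End ℂ (Lp ℂ 2 μ) :=
  Lp.compMeasurePreservingₗ ℂ T hT

/-- `ϱ_n = e^{2^{1-n} π i}`. -/
noncomputable def rho (n : ℕ) : ℂ :=
  Complex.exp ((2 : ℂ) ^ (1 - (n : ℤ)) * (Real.pi : ℂ) * Complex.I)

end OrderedPairs

open OrderedPairs

open OrderedPairs

namespace OrderedPairs

open Function Set Measure
open scoped ENNReal

/-! ### Digits and cylinders -/

/-! The odometer permutes the cylinders `cyl r k` of a given length cyclically, so `ν` is encoded by
the measures `θ_k`: on `B × A_{r,k}` it equals `2^{-k} 𝕊^r θ_k(B)`. Ergodicity of `ν` makes `θ_k`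
and its shifts ergodic for `𝕊^{2^k}`, hence any two of these shifts are equal or mutually singular.

An equality `𝕊^r θ_k = θ_k` with `0 < r < 2^k` yields invariance under `𝕊^{2^{k-1}}`, that is
`θ_{k-1} = θ_k`. Such a coincidence propagates to all larger `k` (`theta_succ_eq`), and an
eventually constant sequence `θ_k` forces periodic type (`isOfPeriodicType_of_theta_eq`).
Aperiodicity therefore gives singularity (`mutuallySingular_map_theta`).

By singularity, measurable sets in `I^ℤ` detect every digit of `α`, so `ν` lives on the graph of a
measurable `φ : I^ℤ → I^ℕ`. The conditional measures are then Dirac, the projection is invertible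
mod 0, `φ` is a factor map onto the odometer, and characters of the 2-adic integers composed with
`φ` are eigenfunctions. -/

/-- The number with binary digits `α 0, …, α (k - 1)`. -/
def digitVal (k : ℕ) (α : SeqN) : ℕ := ∑ i ∈ Finset.range k, (α i : ℕ) * 2 ^ i

lemma mem_cyl {r k : ℕ} {α : SeqN} : α ∈ cyl r k ↔ digitVal k α = r := Iff.rfl

lemma digitVal_zero (α : SeqN) : digitVal 0 α = 0 := by simp [digitVal]

lemma digitVal_succ (k : ℕ) (α : SeqN) :
    digitVal (k + 1) α = digitVal k α + (α k : ℕ) * 2 ^ k := by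
  simp [digitVal, Finset.sum_range_succ]

lemma fin_two_cases (a : Fin 2) : a = 0 ∨ a = 1 := by omega

lemma digitVal_lt (k : ℕ) (α : SeqN) : digitVal k α < 2 ^ k := by
  induction k with
  | zero => simp [digitVal_zero]
  | succ k ih =>
    rw [digitVal_succ, pow_succ]
    rcases fin_two_cases (α k) with h | h <;> simp [h] <;> omega

lemma digitVal_add_one_eq_iff (k : ℕ) (α : SeqN) :
    digitVal k α + 1 = 2 ^ k ↔ ∀ j < k, α j = 1 := by
  induction k with
  | zero => simp [digitVal_zero]
  | succ k ih =>
    rw [digitVal_succ, pow_succ, Nat.forall_lt_succ_right, ← ih]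
    have := digitVal_lt k α
    rcases fin_two_cases (α k) with h | h <;> simp [h] <;> omega

lemma digitVal_odometer (k : ℕ) (α : SeqN) :
    digitVal k (odometer α) = (digitVal k α + 1) % 2 ^ k := by
  induction k with
  | zero => simp [digitVal_zero]
  | succ k ih =>
    have hlt := digitVal_lt k α
    rw [digitVal_succ, digitVal_succ, ih]
    by_cases hc : digitVal k α + 1 = 2 ^ k
    · have ho : odometer α k = 1 - α k := if_pos ((digitVal_add_one_eq_iff k α).1 hc)
      rw [ho, hc]
      rcases fin_two_cases (α k) with h | h
      · rw [h, Nat.mod_eq_of_lt (b := 2 ^ (k + 1))] <;> simp <;> omega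
      · have : digitVal k α + ((1 : Fin 2) : ℕ) * 2 ^ k + 1 = 2 ^ (k + 1) := by
          rw [pow_succ]; simp; omega
        rw [h, this]; simp
    · have ho : odometer α k = α k :=
        if_neg fun h => hc ((digitVal_add_one_eq_iff k α).2 h)
      rw [ho, Nat.mod_eq_of_lt (by omega), Nat.mod_eq_of_lt]
      · ring
      · rw [pow_succ]
        rcases fin_two_cases (α k) with h | h <;> simp [h] <;> omega

lemma digitVal_iterate_odometer (k n : ℕ) (α : SeqN) :
    digitVal k (odometer^[n] α) = (digitVal k α + n) % 2 ^ k := by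
  induction n with
  | zero => simp [Nat.mod_eq_of_lt (digitVal_lt k α)]
  | succ n ih =>
    rw [iterate_succ_apply', digitVal_odometer, ih, Nat.mod_add_mod, add_assoc]

lemma digitVal_mod {l k : ℕ} (h : l ≤ k) (α : SeqN) : digitVal k α % 2 ^ l = digitVal l α := by
  induction k, h using Nat.le_induction with
  | base => exact Nat.mod_eq_of_lt (digitVal_lt l α)
  | succ k hk ih =>
    rw [digitVal_succ, Nat.add_mod, ih,
      Nat.mod_eq_zero_of_dvd ((pow_dvd_pow 2 hk).mul_left _), add_zero,
      Nat.mod_eq_of_lt (digitVal_lt l α)]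

lemma digitVal_eq_iff (k : ℕ) (α β : SeqN) :
    digitVal k α = digitVal k β ↔ ∀ i < k, α i = β i := by
  induction k with
  | zero => simp [digitVal_zero]
  | succ k ih =>
    rw [Nat.forall_lt_succ_right, ← ih, digitVal_succ, digitVal_succ]
    have h1 := digitVal_lt k α
    have h2 := digitVal_lt k β
    rcases fin_two_cases (α k) with h | h <;> rcases fin_two_cases (β k) with h' | h' <;>
      simp [h, h'] <;> omega

lemma exists_digitVal_eq {r k : ℕ} (h : r < 2 ^ k) : ∃ β : SeqN, digitVal k β = r :=
  ⟨odometer^[r] 0, by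
    rw [digitVal_iterate_odometer, show digitVal k 0 = 0 by simp [digitVal], zero_add,
      Nat.mod_eq_of_lt h]⟩

lemma measurable_digitVal (k : ℕ) : Measurable (digitVal k) := by
  unfold digitVal
  have h : Measurable fun a : Fin 2 => (a : ℕ) := measurable_of_countable _
  exact Finset.measurable_sum _ fun i _ =>
    (h.comp (measurable_pi_apply i)).mul measurable_const

lemma measurableSet_cyl (r k : ℕ) : MeasurableSet (cyl r k) :=
  measurable_digitVal k (measurableSet_singleton r)

lemma measurable_shift : Measurable shift :=
  measurable_pi_lambda _ fun n => measurable_pi_apply (n + 1)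

lemma measurable_odometer : Measurable odometer := by
  refine measurable_pi_lambda _ fun i => ?_
  refine Measurable.ite ?_ ?_ (measurable_pi_apply i)
  · have : {α : SeqN | ∀ j < i, α j = 1} = digitVal i ⁻¹' {n | n + 1 = 2 ^ i} := by
      ext α; exact (digitVal_add_one_eq_iff i α).symm
    exact this ▸ measurable_digitVal i (to_countable _).measurableSet
  · exact (measurable_of_countable fun a : Fin 2 => 1 - a).comp (measurable_pi_apply i)

lemma iterate_shiftOdometer (n : ℕ) :
    shiftOdometer^[n] = Prod.map shift^[n] odometer^[n] :=
  Prod.map_iterate _ _ _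

/-- Two finite measures on `I^ℕ` which agree on all sufficiently long cylinders are equal. -/
lemma ext_of_cyl {μ η : Measure SeqN} [IsFiniteMeasure μ] (l : ℕ)
    (h : ∀ k, l ≤ k → ∀ r < 2 ^ k, μ (cyl r k) = η (cyl r k)) : μ = η := by
  have hempty {r k : ℕ} (hr : ¬ r < 2 ^ k) : cyl r k = ∅ :=
    eq_empty_of_forall_notMem fun α hα => hr (mem_cyl.1 hα ▸ digitVal_lt k α)
  have h' : ∀ k, l ≤ k → ∀ r, μ (cyl r k) = η (cyl r k) := fun k hk r => by
    by_cases hr : r < 2 ^ k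
    · exact h k hk r hr
    · simp [hempty hr]
  refine ext_of_generate_finite {s | ∃ k r, l ≤ k ∧ s = cyl r k} ?_ ?_ ?_ ?_
  · refine le_antisymm ?_ (MeasurableSpace.generateFrom_le ?_)
    · refine iSup_le fun i => ?_
      rw [← measurable_iff_comap_le]
      set k := max l (i + 1)
      set m := MeasurableSpace.generateFrom {s : Set SeqN | ∃ k r, l ≤ k ∧ s = cyl r k}
      have hd : Measurable[m] (digitVal k) :=
        measurable_to_countable' fun r =>
          MeasurableSpace.measurableSet_generateFrom ⟨k, r, le_max_left _ _, rfl⟩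
      intro s _
      -- As `i < k`, digit `i` is determined by `digitVal k`, so the preimage is saturated.
      have : (fun α : SeqN => α i) ⁻¹' s = digitVal k ⁻¹' (digitVal k '' ((· i) ⁻¹' s)) := by
        refine (subset_preimage_image _ _).antisymm ?_
        rintro α ⟨β, hβ, hβα⟩
        have : β i = α i :=
          (digitVal_eq_iff k β α).1 hβα i (Nat.lt_of_succ_le (le_max_right l (i + 1)))
        simpa [← this] using hβ
      exact this ▸ hd (to_countable _).measurableSet
    · rintro _ ⟨k, r, _, rfl⟩
      exact measurableSet_cyl r k
  · have key {k k' r r' : ℕ} (hkk : k ≤ k') (hne : (cyl r k ∩ cyl r' k').Nonempty) :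
        cyl r k ∩ cyl r' k' = cyl r' k' := by
      obtain ⟨β, hβ, hβ'⟩ := hne
      refine inter_eq_right.2 fun α hα => ?_
      rw [mem_cyl] at *
      rw [← digitVal_mod hkk, hα, ← hβ', digitVal_mod hkk, hβ]
    rintro _ ⟨k, r, hk, rfl⟩ _ ⟨k', r', hk', rfl⟩ hne
    rcases le_total k k' with hkk | hkk
    · exact ⟨k', r', hk', key hkk hne⟩
    · rw [inter_comm] at hne ⊢
      exact ⟨k, r, hk, key hkk hne⟩
  · rintro _ ⟨k, r, hk, rfl⟩
    exact h' k hk r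
  · have hU : (univ : Set SeqN) = ⋃ r, cyl r l :=
      (iUnion_eq_univ_iff.2 fun α => ⟨digitVal l α, rfl⟩).symm
    have hdis : Pairwise (Disjoint on fun r => cyl r l) := fun r s hrs =>
      disjoint_left.2 fun α hα hα' => hrs ((mem_cyl.1 hα).symm.trans hα')
    rw [hU, measure_iUnion hdis fun r => measurableSet_cyl r l,
      measure_iUnion hdis fun r => measurableSet_cyl r l]
    exact tsum_congr fun r => h' l le_rfl r

instance : IsProbabilityMeasure lebesgue := by unfold lebesgue; infer_instance

lemma lebesgue_cyl {r k : ℕ} (h : r < 2 ^ k) : lebesgue (cyl r k) = (2 ^ k)⁻¹ := by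
  obtain ⟨β, rfl⟩ := exists_digitVal_eq h
  have : cyl (digitVal k β) k = Set.pi (Finset.range k) fun i => {β i} := by
    ext α
    simp [mem_cyl, digitVal_eq_iff]
  rw [this, lebesgue, infinitePi_pi _ fun i _ => measurableSet_singleton _]
  simp [ENNReal.inv_pow]

/-! ### Invariant measures of the product system -/

variable {ν : Measure (SeqZ × SeqN)}

/-- Taking `r < 2^k` gives `ν` over every cylinder; taking `r = 2^k` gives the `𝕊^{2^k}`-invariance
of `θ_k`. -/
lemma preimage_prod_cyl (B : Set SeqZ) (r k : ℕ) :
    shiftOdometer^[r] ⁻¹' (B ×ˢ cyl (r % 2 ^ k) k) = (shift^[r] ⁻¹' B) ×ˢ cyl 0 k := by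
  ext ⟨w, α⟩
  simp only [iterate_shiftOdometer, mem_preimage, Prod.map_apply, mem_prod, mem_cyl,
    digitVal_iterate_odometer, and_congr_right_iff]
  intro _
  have : (digitVal k α + r ≡ 0 + r [MOD 2 ^ k]) ↔ digitVal k α ≡ 0 [MOD 2 ^ k] :=
    ⟨Nat.ModEq.add_right_cancel' r, Nat.ModEq.add_right r⟩
  rw [zero_add] at this
  refine this.trans ?_
  rw [Nat.ModEq, Nat.mod_eq_of_lt (digitVal_lt k α), Nat.zero_mod]

lemma measure_prod_cyl_mod (hν : ν ∈ invMeasures) {B : Set SeqZ} (hB : MeasurableSet B)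
    (r k : ℕ) : ν (B ×ˢ cyl (r % 2 ^ k) k) = ν ((shift^[r] ⁻¹' B) ×ˢ cyl 0 k) := by
  rw [← preimage_prod_cyl, (hν.2.iterate r).measure_preimage
    (hB.prod (measurableSet_cyl _ _)).nullMeasurableSet]

lemma measure_univ_eq_sum_cyl (k : ℕ) :
    ν univ = ∑ r ∈ Finset.range (2 ^ k), ν (univ ×ˢ cyl r k) := by
  have hdis : Pairwise (Disjoint on fun r => (univ : Set SeqZ) ×ˢ cyl r k) := fun r s hrs =>
    disjoint_left.2 fun x hx hx' => hrs ((mem_cyl.1 hx.2).symm.trans hx'.2)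
  have hU : (⋃ r ∈ Finset.range (2 ^ k), (univ : Set SeqZ) ×ˢ cyl r k) = univ :=
    eq_univ_of_forall fun x => mem_iUnion₂.2
      ⟨digitVal k x.2, Finset.mem_range.2 (digitVal_lt k x.2), trivial, rfl⟩
  rw [← hU, measure_biUnion_finset (hdis.set_pairwise _)
    fun r _ => MeasurableSet.univ.prod (measurableSet_cyl r k)]

lemma measure_univ_prod_cyl (hν : ν ∈ invMeasures) (k : ℕ) :
    ν (univ ×ˢ cyl 0 k) = (2 ^ k)⁻¹ := by
  have := hν.1
  have h1 : (1 : ℝ≥0∞) = 2 ^ k * ν (univ ×ˢ cyl 0 k) := by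
    rw [← measure_univ (μ := ν), measure_univ_eq_sum_cyl k,
      Finset.sum_congr rfl (g := fun _ => ν (univ ×ˢ cyl 0 k))]
    · simp
    · intro r hr
      rw [← Nat.mod_eq_of_lt (Finset.mem_range.1 hr),
        measure_prod_cyl_mod hν .univ, preimage_univ]
  exact ENNReal.eq_inv_of_mul_eq_one_left (by rw [h1, mul_comm])

lemma theta_apply (hν : ν ∈ invMeasures) (k : ℕ) {B : Set SeqZ} (hB : MeasurableSet B) :
    theta k ν B = 2 ^ k * ν (B ×ˢ cyl 0 k) := by
  have hm : MeasurableSet (Prod.snd (α := SeqZ) ⁻¹' cyl 0 k) :=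
    measurable_snd (measurableSet_cyl 0 k)
  rw [theta, partialProj, map_apply measurable_fst hB, cond_apply hm, ← univ_prod,
    measure_univ_prod_cyl hν, inv_inv, inter_comm, univ_prod, ← prod_eq]

lemma isProbabilityMeasure_theta (hν : ν ∈ invMeasures) (k : ℕ) :
    IsProbabilityMeasure (theta k ν) :=
  ⟨by rw [theta_apply hν k .univ, measure_univ_prod_cyl hν,
    ENNReal.mul_inv_cancel (by simp) (by finiteness)]⟩

lemma measure_prod_cyl (hν : ν ∈ invMeasures) {r k : ℕ} (hr : r < 2 ^ k) {B : Set SeqZ}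
    (hB : MeasurableSet B) :
    ν (B ×ˢ cyl r k) = (2 ^ k)⁻¹ * (theta k ν).map shift^[r] B := by
  rw [map_apply (measurable_shift.iterate r) hB, theta_apply hν k (measurable_shift.iterate r hB),
    ← measure_prod_cyl_mod hν hB, Nat.mod_eq_of_lt hr, ← mul_assoc,
    ENNReal.inv_mul_cancel (by simp) (by finiteness), one_mul]

lemma measurePreserving_theta (hν : ν ∈ invMeasures) (k : ℕ) :
    MeasurePreserving shift^[2 ^ k] (theta k ν) (theta k ν) := by
  refine ⟨measurable_shift.iterate _, ?_⟩
  ext B hB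
  rw [map_apply (measurable_shift.iterate _) hB,
    theta_apply hν k (measurable_shift.iterate _ hB), theta_apply hν k hB,
    ← measure_prod_cyl_mod hν hB, Nat.mod_self]

lemma theta_zero (hν : ν ∈ invMeasures) : theta 0 ν = ν.map Prod.fst := by
  ext B hB
  rw [theta_apply hν 0 hB, map_apply measurable_fst hB,
    show cyl 0 0 = univ from eq_univ_of_forall digitVal_zero, prod_univ]
  simp

lemma map_snd_eq_lebesgue (hν : ν ∈ invMeasures) : ν.map Prod.snd = lebesgue := by
  have := hν.1
  have := isProbabilityMeasure_map (μ := ν) measurable_snd.aemeasurable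
  refine ext_of_cyl 0 fun k _ r hr => ?_
  have := isProbabilityMeasure_theta hν k
  have := isProbabilityMeasure_map (μ := theta k ν) (measurable_shift.iterate r).aemeasurable
  rw [map_apply measurable_snd (measurableSet_cyl r k), ← univ_prod, measure_prod_cyl hν hr .univ,
    lebesgue_cyl hr, measure_univ, mul_one]

/-- `A_{0,k}` splits into `A_{0,k+1}` and `A_{2^k,k+1}`, which have equal mass. -/
lemma theta_eq_half_add (hν : ν ∈ invMeasures) (k : ℕ) :
    theta k ν = (2 : ℝ≥0∞)⁻¹ • (theta (k + 1) ν + (theta (k + 1) ν).map shift^[2 ^ k]) := by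
  ext B hB
  have hlt : 2 ^ k < 2 ^ (k + 1) := Nat.pow_lt_pow_right one_lt_two k.lt_succ_self
  have hsplit : cyl 0 k = cyl 0 (k + 1) ∪ cyl (2 ^ k) (k + 1) := by
    ext α
    simp only [mem_union, mem_cyl, digitVal_succ]
    have := digitVal_lt k α
    have : 0 < 2 ^ k := by positivity
    rcases fin_two_cases (α k) with h | h <;> simp [h]
    omega
  have hdis : Disjoint (B ×ˢ cyl 0 (k + 1)) (B ×ˢ cyl (2 ^ k) (k + 1)) := by
    refine disjoint_left.2 fun x hx hx' => ?_
    have h := (mem_cyl.1 hx.2).symm.trans hx'.2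
    exact absurd h (by positivity)
  rw [theta_apply hν k hB, hsplit, prod_union,
    measure_union hdis (hB.prod (measurableSet_cyl _ _)), measure_prod_cyl hν hlt hB,
    measure_prod_cyl hν (by positivity) hB, iterate_zero, map_id, ← mul_add, ← mul_assoc,
    Measure.smul_apply, Measure.add_apply, smul_eq_mul]
  congr 1
  rw [pow_succ, ENNReal.mul_inv (by simp) (by simp), ← mul_assoc,
    ENNReal.mul_inv_cancel (by simp) (by finiteness), one_mul]

/-! ### Ergodicity and the dichotomy -/

/-- Two ergodic probability measures of a transformation are equal or mutually singular. -/
lemma eq_or_mutuallySingular {X : Type*} [MeasurableSpace X] {f : X → X} {μ η : Measure X}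
    [IsProbabilityMeasure μ] [IsProbabilityMeasure η] (hμ : Ergodic f μ) (hη : Ergodic f η) :
    μ = η ∨ η ⟂ₘ μ := by
  -- The absolutely continuous part of `η` is invariant, hence a multiple `c • μ`. If `c = 0`, `η`
  -- is singular; otherwise `μ ≪ η`, and ergodicity of `η` gives equality.
  obtain ⟨c, hc⟩ := hμ.eq_smul_of_absolutelyContinuous
    (hη.toMeasurePreserving.withDensity_rnDeriv hμ.toMeasurePreserving)
    (withDensity_absolutelyContinuous _ _)
  have hdec := haveLebesgueDecomposition_add η μ
  rcases eq_or_ne c 0 with rfl | h0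
  · right
    rw [hc, zero_smul, add_zero] at hdec
    rw [hdec]
    exact mutuallySingular_singularPart η μ
  · left
    refine hη.eq_of_absolutelyContinuous hμ.toMeasurePreserving ?_
    refine (absolutelyContinuous_smul h0).trans ?_
    rw [← hc]
    exact (withDensity_rnDeriv_le η μ).absolutelyContinuous

lemma ergodic_theta (hν : ν ∈ ergodicInvMeasures) (k : ℕ) :
    Ergodic shift^[2 ^ k] (theta k ν) := by
  have := hν.1.1
  have := isProbabilityMeasure_theta hν.1 k
  refine ⟨measurePreserving_theta hν.1 k, ⟨fun B hB hBinv => ?_⟩⟩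
  -- Spread `B × A_{0,k}` along orbits: from `A_{d,k}`, `2^k - d` steps lead back to `A_{0,k}`. For
  -- `d = 0` this takes `2^k` steps instead of none, which is harmless since `B` is
  -- `𝕊^{2^k}`-invariant.
  set E : Set (SeqZ × SeqN) := {x | shift^[2 ^ k - digitVal k x.2] x.1 ∈ B} with hE
  have hEm : MeasurableSet E := by
    have : E = ⋃ r, (shift^[2 ^ k - r] ⁻¹' B) ×ˢ cyl r k := by
      ext x
      simp [hE, mem_cyl]
    rw [this]
    exact .iUnion fun r => (measurable_shift.iterate _ hB).prod (measurableSet_cyl r k)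
  have hinv (w : SeqZ) : shift^[2 ^ k] w ∈ B ↔ w ∈ B := by
    conv_rhs => rw [← hBinv]
    rfl
  have hEinv : shiftOdometer ⁻¹' E = E := by
    ext ⟨w, α⟩
    simp only [hE, shiftOdometer, mem_preimage, Prod.map_apply, mem_ofPred_eq, digitVal_odometer,
      ← iterate_succ_apply]
    have hlt := digitVal_lt k α
    rcases eq_or_ne (digitVal k α + 1) (2 ^ k) with h | h
    · rw [h, Nat.mod_self, Nat.sub_zero, iterate_succ_apply, hinv,
        show 2 ^ k - digitVal k α = 1 by omega, iterate_one]
    · rw [Nat.mod_eq_of_lt (by omega)]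
      congr! 2
      omega
  have hsec : E ∩ (univ ×ˢ cyl 0 k) = B ×ˢ cyl 0 k := by
    ext ⟨w, α⟩
    simp only [hE, mem_inter_iff, mem_prod, mem_univ, true_and, mem_cyl, mem_ofPred_eq]
    refine and_congr_left fun h => ?_
    rw [h, Nat.sub_zero, hinv]
  have hval : theta k ν B = 0 ∨ theta k ν B = 1 := by
    rw [theta_apply hν.1 k hB, ← hsec]
    rcases hν.2.toPreErgodic.prob_eq_zero_or_one hEm hEinv with h | h
    · left
      rw [measure_inter_null_of_null_left _ h, mul_zero]
    · right
      rw [inter_comm, measure_inter_conull ((prob_compl_eq_zero_iff hEm).2 h),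
        measure_univ_prod_cyl hν.1, ENNReal.mul_inv_cancel (by simp) (by finiteness)]
  rw [Filter.eventuallyConst_set']
  rcases hval with h | h
  · exact .inl (ae_eq_empty.2 h)
  · exact .inr (ae_eq_univ.2 ((prob_compl_eq_zero_iff hB).2 h))

lemma ergodic_map_theta (hν : ν ∈ ergodicInvMeasures) (k r : ℕ) :
    Ergodic shift^[2 ^ k] ((theta k ν).map shift^[r]) :=
  (measurable_shift.iterate r).measurePreserving _ |>.ergodic_of_ergodic_semiconj
    (ergodic_theta hν k) (measurable_shift.iterate _)
    ((Function.Commute.refl shift).iterate_iterate r _ : Semiconj _ _ _)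

lemma map_iterate_map (μ : Measure SeqZ) (r s : ℕ) :
    (μ.map shift^[r]).map shift^[s] = μ.map shift^[s + r] := by
  rw [map_map (measurable_shift.iterate s) (measurable_shift.iterate r), ← iterate_add]

lemma map_iterate_mul {μ : Measure SeqZ} {r : ℕ} (h : μ.map shift^[r] = μ) (n : ℕ) :
    μ.map shift^[r * n] = μ := by
  induction n with
  | zero => simp
  | succ n ih => rw [Nat.mul_succ, ← map_iterate_map, h, ih]

lemma map_iterate_of_mod_eq {μ : Measure SeqZ} {r n m : ℕ} (h : μ.map shift^[r] = μ)
    (hmod : n ≡ m [MOD r]) : μ.map shift^[n] = μ.map shift^[m] := by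
  have key (n : ℕ) : μ.map shift^[n] = μ.map shift^[n % r] := by
    conv_lhs => rw [← Nat.mod_add_div n r, ← map_iterate_map, map_iterate_mul h]
  rw [key n, key m, hmod]

lemma map_theta_eq_half_add (hν : ν ∈ invMeasures) (k r : ℕ) :
    (theta k ν).map shift^[r] = (2 : ℝ≥0∞)⁻¹ •
      ((theta (k + 1) ν).map shift^[r] + (theta (k + 1) ν).map shift^[2 ^ k + r]) := by
  conv_lhs => rw [theta_eq_half_add hν]
  rw [Measure.map_smul, Measure.map_add _ _ (measurable_shift.iterate r), map_iterate_map,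
    add_comm r]

lemma half_smul_add_self (μ : Measure SeqZ) : (2 : ℝ≥0∞)⁻¹ • (μ + μ) = μ := by
  rw [← two_smul ℝ≥0∞ μ, smul_smul, ENNReal.inv_mul_cancel (by simp) (by simp), one_smul]

lemma theta_eq_of_map_eq (hν : ν ∈ invMeasures) {k : ℕ}
    (h : (theta (k + 1) ν).map shift^[2 ^ k] = theta (k + 1) ν) : theta k ν = theta (k + 1) ν := by
  rw [theta_eq_half_add hν, h, half_smul_add_self]

/-- If the measures `θ_k` and `θ_{k+1}` are equal, then so are `θ_{k+1}` and `θ_{k+2}`. -/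
lemma theta_succ_eq (hν : ν ∈ ergodicInvMeasures) {k : ℕ} (h : theta k ν = theta (k + 1) ν) :
    theta (k + 1) ν = theta (k + 2) ν := by
  refine theta_eq_of_map_eq hν.1 ?_
  have hp := isProbabilityMeasure_theta hν.1 (k + 2)
  have hpm (r : ℕ) := isProbabilityMeasure_map (μ := theta (k + 2) ν)
    (measurable_shift.iterate r).aemeasurable
  set a := theta (k + 2) ν with ha
  have hper : a.map shift^[2 ^ (k + 2)] = a := (measurePreserving_theta hν.1 (k + 2)).map_eq
  have hinv : (theta (k + 1) ν).map shift^[2 ^ k] = theta (k + 1) ν :=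
    h ▸ (measurePreserving_theta hν.1 k).map_eq
  rw [map_theta_eq_half_add hν.1, theta_eq_half_add hν.1 (k + 1), ← ha] at hinv
  -- `hinv` now says that `a + 𝕊^{2·2^k} a` and `𝕊^{2^k} a + 𝕊^{3·2^k} a` have equal halves. As `a`
  -- is dominated by the first sum, it cannot be singular to both terms of the second.
  have hor : a.map shift^[2 ^ k] = a ∨ a.map shift^[2 ^ (k + 1) + 2 ^ k] = a := by
    by_contra! hne
    have hs (r : ℕ) (hr : a.map shift^[r] ≠ a) : a ⟂ₘ a.map shift^[r] :=
      (eq_or_mutuallySingular (ergodic_map_theta hν (k + 2) r)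
        (ergodic_theta hν (k + 2))).resolve_left hr
    have hsum := ((hs _ hne.1).add_right (hs _ hne.2)).symm.smul (2 : ℝ≥0∞)⁻¹
    rw [hinv] at hsum
    have := eq_zero_of_absolutelyContinuous_of_mutuallySingular (μ := a)
      ((absolutelyContinuous_of_le (Measure.le_add_right le_rfl)).trans
        (absolutelyContinuous_smul (by simp))) hsum.symm
    exact IsProbabilityMeasure.ne_zero a this
  have hq : a.map shift^[2 ^ k] = a := by
    refine hor.elim id fun h3 => ?_
    -- `3 · 3 ≡ 1` modulo `4`, so the period `3 · 2^k` yields `2^k` modulo `2^{k+2}`.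
    rw [← map_iterate_of_mod_eq hper (n := (2 ^ (k + 1) + 2 ^ k) * 3), map_iterate_mul h3]
    have : (2 ^ (k + 1) + 2 ^ k) * 3 = 2 ^ k + 2 ^ (k + 2) * 2 := by ring
    rw [this]
    simp [Nat.ModEq]
  simpa [pow_succ] using map_iterate_mul hq 2

/-- For fixed `B`, compare the two measures on cylinders of length `k ≥ l`: since `θ_k = θ_l`, the
mass over `A_{r,k}` depends on `r` only modulo `2^l`, and only the summand `i = r % 2^l` of
`D_l[θ_l]` charges it. -/
lemma isOfPeriodicType_of_theta_eq (hν : ν ∈ invMeasures) {l : ℕ}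
    (h : ∀ k, l ≤ k → theta k ν = theta l ν) : IsOfPeriodicType ν := by
  have := hν.1
  have hp := isProbabilityMeasure_theta hν l
  refine ⟨l, theta l ν, ⟨hp, measurePreserving_theta hν l⟩, ?_⟩
  have hper := (measurePreserving_theta hν l).map_eq
  have hpm (r : ℕ) := isProbabilityMeasure_map (μ := theta l ν)
    (measurable_shift.iterate r).aemeasurable
  refine ext_prod fun {B C} hB hC => ?_
  have key : (ν.restrict (Prod.fst ⁻¹' B)).map Prod.snd =
      ((periodicMeasure l (theta l ν)).restrict (Prod.fst ⁻¹' B)).map Prod.snd := by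
    refine ext_of_cyl l fun k hk r hr => ?_
    have hm := measurableSet_cyl r k
    have hset : Prod.snd ⁻¹' cyl r k ∩ Prod.fst ⁻¹' B = B ×ˢ cyl r k := by
      rw [inter_comm, prod_eq]
    rw [map_apply measurable_snd hm, map_apply measurable_snd hm,
      restrict_apply (measurable_snd hm), restrict_apply (measurable_snd hm), hset,
      measure_prod_cyl hν hr hB, h k hk, periodicMeasure, finsetSum_apply,
      Finset.sum_eq_single_of_mem (r % 2 ^ l) (Finset.mem_range.2 (Nat.mod_lt _ (by positivity)))]
    · have hsub : cyl r k ⊆ cyl (r % 2 ^ l) l := fun α hα => by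
        rw [mem_cyl] at *
        rw [← digitVal_mod hk, hα]
      rw [prod_prod, restrict_apply hm, inter_eq_left.2 hsub, lebesgue_cyl hr,
        map_iterate_of_mod_eq hper (Nat.mod_modEq r _), mul_comm]
    · intro i _ hi
      have hdis : cyl r k ∩ cyl i l = ∅ := by
        refine eq_empty_of_forall_notMem fun α hα => hi ?_
        rw [← mem_cyl.1 hα.2, ← mem_cyl.1 hα.1, digitVal_mod hk]
      rw [prod_prod, restrict_apply hm, hdis, measure_empty, mul_zero]
  have := congrArg (· C) key
  simpa [map_apply measurable_snd hC, restrict_apply (measurable_snd hC), inter_comm,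
    ← prod_eq] using this

lemma isOfPeriodicType_of_map_theta_eq (hν : ν ∈ ergodicInvMeasures) {k r : ℕ} (hr : 0 < r)
    (hrk : r < 2 ^ k) (h : (theta k ν).map shift^[r] = theta k ν) : IsOfPeriodicType ν := by
  obtain ⟨j, m, hm, rfl⟩ := Nat.exists_eq_two_pow_mul_odd hr.ne'
  have hjk : j < k := by
    by_contra! hkj
    have := Nat.pow_le_pow_right two_pos hkj
    have := Nat.le_mul_of_pos_right (2 ^ j) hm.pos
    omega
  obtain ⟨n, rfl⟩ := Nat.exists_eq_add_of_lt hjk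
  obtain ⟨t, rfl⟩ := hm
  have hper := (measurePreserving_theta hν.1 (j + n + 1)).map_eq
  -- With `r = 2^j (2t + 1)` and `k = j + n + 1`, the multiple `2^n r` is congruent to `2^{k-1}`
  -- modulo `2^k`.
  have hhalf : (theta (j + n + 1) ν).map shift^[2 ^ (j + n)] = theta (j + n + 1) ν := by
    rw [← map_iterate_of_mod_eq hper (n := 2 ^ j * (2 * t + 1) * 2 ^ n), map_iterate_mul h]
    have : 2 ^ j * (2 * t + 1) * 2 ^ n = 2 ^ (j + n) + 2 ^ (j + n + 1) * t := by ring
    rw [this]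
    simp [Nat.ModEq]
  have hstep (i : ℕ) : theta (j + n + i) ν = theta (j + n + i + 1) ν := by
    induction i with
    | zero => exact theta_eq_of_map_eq hν.1 hhalf
    | succ i ih => exact theta_succ_eq hν ih
  refine isOfPeriodicType_of_theta_eq hν.1 (l := j + n) fun k hk => ?_
  induction k, hk using Nat.le_induction with
  | base => rfl
  | succ k hk ih =>
    obtain ⟨i, rfl⟩ := Nat.exists_eq_add_of_le hk
    rw [← hstep, ih]

/-- For an aperiodic ergodic measure, the projections of its restrictions to different cylinders
of the same length are mutually singular. -/
lemma mutuallySingular_map_theta (hν : ν ∈ ergodicInvMeasures) (hap : ¬ IsOfPeriodicType ν)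
    {k r s : ℕ} (hrs : r < s) (hs : s < 2 ^ k) :
    (theta k ν).map shift^[r] ⟂ₘ (theta k ν).map shift^[s] := by
  have hp := isProbabilityMeasure_theta hν.1 k
  have hpm (r : ℕ) := isProbabilityMeasure_map (μ := theta k ν)
    (measurable_shift.iterate r).aemeasurable
  refine (eq_or_mutuallySingular (ergodic_map_theta hν k s)
    (ergodic_map_theta hν k r)).resolve_left fun h => hap ?_
  refine isOfPeriodicType_of_map_theta_eq hν (k := k) (r := s - r) (by omega) (by omega) ?_
  have hper := (measurePreserving_theta hν.1 k).map_eq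
  -- Shifting by `2^k - r` completes `r` to a full period and turns the equality into invariance of
  -- `θ_k` under `𝕊^{s-r}`.
  have h' := congrArg (Measure.map shift^[2 ^ k - r]) h
  rw [map_iterate_map, map_iterate_map, Nat.sub_add_cancel (hrs.trans hs).le, hper] at h'
  rw [← map_iterate_of_mod_eq hper (n := 2 ^ k - r + s), h']
  rw [show 2 ^ k - r + s = s - r + 2 ^ k by omega]
  simp [Nat.ModEq]

/-! ### The `2`-adic coordinate as a function of the sequence -/

lemma exists_measurableSet_digit (hν : ν ∈ ergodicInvMeasures) (hap : ¬ IsOfPeriodicType ν)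
    (k : ℕ) : ∃ B : Set SeqZ, MeasurableSet B ∧ ∀ᵐ x ∂ν, x.1 ∈ B ↔ x.2 k = 1 := by
  set μ : ℕ → Measure SeqZ := fun r => (theta (k + 1) ν).map shift^[r]
  -- Among cylinders of length `k + 1`, those numbered below `2^k` have digit `k` equal to `0`, the
  -- others `1`. A set separating the two sums reads off this digit.
  have hsing : Measure.sum (fun r : Fin (2 ^ k) => μ r) ⟂ₘ
      Measure.sum fun s : Fin (2 ^ k) => μ (2 ^ k + s) := by
    refine MutuallySingular.sum_left.2 fun r => MutuallySingular.sum_right.2 fun s => ?_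
    refine mutuallySingular_map_theta hν hap ?_ ?_
    · have := r.2
      omega
    · rw [pow_succ]
      have := s.2
      omega
  obtain ⟨B, hB, h0, h1⟩ := hsing
  simp only [Measure.sum_apply _ hB, Measure.sum_apply _ hB.compl, ENNReal.tsum_eq_zero] at h0 h1
  have hnull {r : ℕ} (hr : r < 2 ^ (k + 1)) {C : Set SeqZ} (hC : MeasurableSet C)
      (h : μ r C = 0) : ∀ᵐ x ∂ν, ¬ (x.1 ∈ C ∧ digitVal (k + 1) x.2 = r) := by
    rw [ae_iff]
    simp only [not_not]
    exact (measure_prod_cyl hν.1 hr hC).trans (by rw [h, mul_zero])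
  refine ⟨B, hB, ?_⟩
  have hlow : ∀ᵐ x ∂ν, ∀ r : Fin (2 ^ k), ¬ (x.1 ∈ B ∧ digitVal (k + 1) x.2 = r) :=
    ae_all_iff.2 fun r => hnull (r.2.trans (Nat.pow_lt_pow_right one_lt_two k.lt_succ_self)) hB
      (h0 r)
  have hhigh : ∀ᵐ x ∂ν, ∀ r : Fin (2 ^ k), ¬ (x.1 ∈ Bᶜ ∧ digitVal (k + 1) x.2 = 2 ^ k + r) :=
    ae_all_iff.2 fun r => hnull (by rw [pow_succ]; have := r.2; omega) hB.compl (h1 r)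
  filter_upwards [hlow, hhigh] with x hx0 hx1
  have hlt := digitVal_lt k x.2
  have h0' := hx0 ⟨_, hlt⟩
  have h1' := hx1 ⟨_, hlt⟩
  rw [digitVal_succ] at h0' h1'
  rcases fin_two_cases (x.2 k) with h | h
  · simpa [h] using h0'
  · simpa [h, add_comm] using h1'

/-- For an aperiodic ergodic measure, the second coordinate is almost everywhere a measurable
function of the first one. -/
lemma exists_measurable_snd_ae_eq (hν : ν ∈ ergodicInvMeasures) (hap : ¬ IsOfPeriodicType ν) :
    ∃ φ : SeqZ → SeqN, Measurable φ ∧ ∀ᵐ x ∂ν, x.2 = φ x.1 := by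
  classical
  choose B hB h using exists_measurableSet_digit hν hap
  refine ⟨fun w k => if w ∈ B k then 1 else 0,
    measurable_pi_lambda _ fun k => .ite (hB k) measurable_const measurable_const, ?_⟩
  filter_upwards [ae_all_iff.2 h] with x hx
  ext1 k
  rcases fin_two_cases (x.2 k) with h' | h' <;> simp [hx k, h']

section Graph

variable {φ : SeqZ → SeqN}

lemma map_theta_zero_graph (hν : ν ∈ invMeasures) (hφ : Measurable φ)
    (h : ∀ᵐ x ∂ν, x.2 = φ x.1) : (theta 0 ν).map (fun w => (w, φ w)) = ν := by
  have hg : Measurable fun w => (w, φ w) := measurable_id.prodMk hφ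
  rw [theta_zero hν, map_map hg measurable_fst]
  conv_rhs => rw [← Measure.map_id (μ := ν)]
  refine Measure.map_congr ?_
  filter_upwards [h] with x hx
  exact Prod.ext rfl hx.symm

/-- A measure carried by a graph disintegrates into Dirac measures, and disintegrations are a.e.
unique. -/
lemma condKernel_ae_eq_dirac [IsProbabilityMeasure ν] (hν : ν ∈ invMeasures) (hφ : Measurable φ)
    (h : ∀ᵐ x ∂ν, x.2 = φ x.1) : ∀ᵐ w ∂theta 0 ν, ν.condKernel w = dirac (φ w) := by
  have heq : ν = ν.fst ⊗ₘ Kernel.deterministic φ hφ := by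
    rw [Measure.compProd_deterministic, Measure.fst, ← theta_zero hν, map_theta_zero_graph hν hφ h]
  rw [theta_zero hν]
  filter_upwards [eq_condKernel_of_measure_eq_compProd (Kernel.deterministic φ hφ) heq] with w hw
  rw [← hw, Kernel.deterministic_apply]

lemma measurePreserving_shift_theta_zero (hν : ν ∈ invMeasures) :
    MeasurePreserving shift (theta 0 ν) (theta 0 ν) := by
  simpa using measurePreserving_theta hν 0

lemma measurePreserving_fst_theta_zero (hν : ν ∈ invMeasures) :
    MeasurePreserving Prod.fst ν (theta 0 ν) :=
  ⟨measurable_fst, (theta_zero hν).symm⟩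

lemma isSystemIso_fst (hν : ν ∈ invMeasures) (hφ : Measurable φ) (h : ∀ᵐ x ∂ν, x.2 = φ x.1) :
    IsSystemIso (Prod.fst : SeqZ × SeqN → SeqZ) shiftOdometer ν shift (theta 0 ν) where
  source_preserving := hν.2
  target_preserving := measurePreserving_shift_theta_zero hν
  map_preserving := measurePreserving_fst_theta_zero hν
  semiconj := .of_forall fun _ => rfl
  exists_inverse := ⟨fun w => (w, φ w),
    ⟨measurable_id.prodMk hφ, map_theta_zero_graph hν hφ h⟩,
    h.mono fun _ hx => Prod.ext rfl hx.symm, .of_forall fun _ => rfl⟩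

/-- `lebesgue` is the second marginal of `ν`, so it inherits invariance. -/
lemma measurePreserving_odometer (hν : ν ∈ invMeasures) :
    MeasurePreserving odometer lebesgue lebesgue := by
  rw [← map_snd_eq_lebesgue hν]
  exact (measurable_snd.measurePreserving ν).of_semiconj hν.2 (fun _ => rfl) measurable_odometer

lemma isFactorMap_of_ae_eq (hν : ν ∈ invMeasures) (hφ : Measurable φ)
    (h : ∀ᵐ x ∂ν, x.2 = φ x.1) : IsFactorMap φ shift (theta 0 ν) odometer lebesgue where
  source_preserving := measurePreserving_shift_theta_zero hν
  target_preserving := measurePreserving_odometer hν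
  map_preserving := by
    refine ⟨hφ, ?_⟩
    rw [← map_snd_eq_lebesgue hν, theta_zero hν, map_map hφ measurable_fst]
    exact Measure.map_congr (h.mono fun _ hx => hx.symm)
  semiconj := by
    have hm : MeasurableSet {w | (φ ∘ shift) w = (odometer ∘ φ) w} :=
      measurableSet_eq_fun (hφ.comp measurable_shift) (measurable_odometer.comp hφ)
    change ∀ᵐ w ∂theta 0 ν, (φ ∘ shift) w = (odometer ∘ φ) w
    rw [theta_zero hν, ae_map_iff measurable_fst.aemeasurable hm]
    -- The graph relation is used both at `x` and at its image under `shiftOdometer`.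
    filter_upwards [h, hν.2.quasiMeasurePreserving.ae h] with x hx hTx
    simp only [comp_apply, ← hx]
    exact hTx.symm

end Graph

/-! ### Eigenfunctions -/

lemma rho_pow_two_pow (n : ℕ) : rho n ^ 2 ^ n = 1 := by
  rw [rho, ← Complex.exp_nat_mul, Complex.exp_eq_one_iff]
  refine ⟨1, ?_⟩
  have h2 : (2 : ℂ) ≠ 0 := two_ne_zero
  push_cast
  rw [zpow_sub₀ h2, zpow_one, zpow_natCast]
  field_simp

lemma norm_rho (n : ℕ) : ‖rho n‖ = 1 :=
  Complex.norm_eq_one_of_pow_eq_one (rho_pow_two_pow n) (by positivity)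

/-- A system which has the odometer as a quotient has the eigenvalues `ϱ_n`. -/
lemma hasEigenvalue_koopman_rho {X : Type*} [MeasurableSpace X] {T : X → X} {μ : Measure X}
    [IsProbabilityMeasure μ] {φ : X → SeqN} (hφ : IsFactorMap φ T μ odometer lebesgue) (n : ℕ) :
    (koopman T hφ.source_preserving).HasEigenvalue (rho n) := by
  -- The odometer adds `1` to `digitVal n` modulo `2^n`, and `rho n ^ 2 ^ n = 1`, so `f` is
  -- multiplied by `rho n`.
  set f : X → ℂ := fun x => rho n ^ digitVal n (φ x) with hf
  have hfm : Measurable f :=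
    (measurable_of_countable fun k : ℕ => rho n ^ k).comp
      ((measurable_digitVal n).comp hφ.map_preserving.measurable)
  have hnorm (x : X) : ‖f x‖ = 1 := by simp [hf, norm_rho]
  have hLp : MemLp f 2 μ :=
    .of_bound hfm.aestronglyMeasurable 1 (.of_forall fun x => (hnorm x).le)
  refine Module.End.hasEigenvalue_of_hasEigenvector (x := hLp.toLp f)
    ⟨Module.End.mem_eigenspace_iff.2 ?_, fun h0 => ?_⟩
  · change Lp.compMeasurePreserving T hφ.source_preserving (hLp.toLp f) = _
    rw [Lp.toLp_compMeasurePreserving, ← MemLp.toLp_const_smul]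
    refine MemLp.toLp_congr _ _ ?_
    filter_upwards [hφ.semiconj] with x hx
    simp only [comp_apply] at hx
    simp only [hf, comp_apply, hx, digitVal_odometer, Pi.smul_apply, smul_eq_mul]
    rw [← pow_succ', ← pow_eq_pow_mod _ (rho_pow_two_pow n)]
  · have hz : f =ᵐ[μ] 0 := by
      rw [← MemLp.toLp_eq_toLp_iff hLp MemLp.zero, h0, MemLp.toLp_zero]
    obtain ⟨x, hx⟩ := hz.exists
    have := hnorm x
    simp [hx] at this

end OrderedPairs

theorem corollary6 (ν : Measure (SeqZ × SeqN)) [IsProbabilityMeasure ν]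
    (hν : ν ∈ ergodicInvMeasures) (hap : IsAperiodic ν) :
    -- mutual singularity
    (∀ k r : ℕ, 1 ≤ k → 1 ≤ r → r ≤ 2 ^ k - 1 →
      theta k ν ⟂ₘ (theta k ν).map (shift^[r])) ∧
    -- the conditional measures on the sections `{w} × I^ℕ` are delta measures
    (∀ᵐ w ∂(theta 0 ν), ∃ α : SeqN, ν.condKernel w = Measure.dirac α) ∧
    -- the projection is an isomorphism of dynamical systems
    IsSystemIso (Prod.fst : SeqZ × SeqN → SeqZ) shiftOdometer ν shift (theta 0 ν) ∧
    -- eigenvalues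
    (∃ hS : MeasurePreserving shift (theta 0 ν) (theta 0 ν),
      ∀ n : ℕ, (koopman shift hS).HasEigenvalue (rho n)) ∧
    -- the odometer is a quotient
    (∃ φ : SeqZ → SeqN, IsFactorMap φ shift (theta 0 ν) odometer lebesgue) := by
  have := isProbabilityMeasure_theta hν.1 0
  obtain ⟨φ, hφ, h⟩ := exists_measurable_snd_ae_eq hν hap.2
  have hfac := isFactorMap_of_ae_eq hν.1 hφ h
  refine ⟨fun k r _ hr hrk => ?_, ?_, isSystemIso_fst hν.1 hφ h,
    ⟨hfac.source_preserving, hasEigenvalue_koopman_rho hfac⟩, φ, hfac⟩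
  · simpa using mutuallySingular_map_theta hν hap.2 (r := 0) (s := r) (k := k) (by omega)
      (by have := Nat.one_le_two_pow (n := k); omega)
  · exact (condKernel_ae_eq_dirac hν.1 hφ h).mono fun w hw => ⟨φ w, hw⟩
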